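/- Let $X$ be a finite-dimensional real Banach space and let $(x_n)$ be a sequence of points of $X$. A point $s\in X$ is called a potential sum of the series $\sum_n x_n$ if there is a permutation $\sigma$ of the index set $\mathbb N$ such that the partial sums of the rearranged series $\sum_n x_{\sigma(n)}$ converge to $s$. Let $\Sigma\subseteq X$ be the set of all potential sums of $\sum_n x_n$, let $\Gamma=\{f\in X^*:\sum_n|f(x_n)|<\infty\}$, and let $\Gamma^\perp=\bigcap_{f\in\Gamma}f^{-1}(0)\subseteq X$. Then: (1) $\Sigma$ is a (possibly empty) affine subspace of $X$; (2) $\Sigma=\Sigma+\Gamma^\perp$; (3) $\Sigma$ is non-empty if and only if for every linear functional $f\in X^*$ there is a permutation $\sigma_f$ of $\mathbb N$ (which may depend on $f$) such that the real series $\sum_n f(x_{\sigma_f(n)})$ converges. -/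

import Mathlib

open scoped Pointwise

/-- The series `∑ xₙ` is potentially convergent to `s`: for some permutation `σ` of the indices,
the sequence of partial sums of the rearranged series `∑ x (σ n)` converges to `s`. -/
def IsPotentialSum {X : Type*} [NormedAddCommGroup X] (x : ℕ → X) (s : X) : Prop :=
  ∃ σ : Equiv.Perm ℕ,
    Filter.Tendsto (fun m : ℕ => ∑ n ∈ Finset.range m, x (σ n)) Filter.atTop (nhds s)

/-- The set `Σ` of all potential sums of the series `∑ xₙ`. -/
def potentialSums {X : Type*} [NormedAddCommGroup X] (x : ℕ → X) : Set X :=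
  {s | IsPotentialSum x s}

/-- The series `∑ xₙ` is *-potentially convergent: for every continuous linear functional `f`,
the real series `∑ f xₙ` is potentially convergent to some real number (the permutation
may depend on `f`). -/
def StarPotentiallyConvergent {X : Type*} [NormedAddCommGroup X] [NormedSpace ℝ X]
    (x : ℕ → X) : Prop :=
  ∀ f : X →L[ℝ] ℝ, ∃ r : ℝ, IsPotentialSum (fun n => f (x n)) r

/-- The set `Γ` of continuous linear functionals `f` with `∑ |f xₙ| < ∞`. -/
def absSummableFunctionals {X : Type*} [NormedAddCommGroup X] [NormedSpace ℝ X]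
    (x : ℕ → X) : Set (X →L[ℝ] ℝ) :=
  {f | Summable fun n => |f (x n)|}

/-- The annihilator `G^⊥ = ⋂ f ∈ G, f⁻¹(0)` in `X` of a set `G` of functionals. -/
def annihilator {X : Type*} [NormedAddCommGroup X] [NormedSpace ℝ X]
    (G : Set (X →L[ℝ] ℝ)) : Set X :=
  ⋂ f ∈ G, f ⁻¹' {0}

/-! Let `p` be a linear projection of X onto V = Γ^⊥. For every functional f, f − f∘p kills V, so it
lies in Γ by finite-dimensional biduality; hence x_n − p(x_n) is summable and its sum does not
depend on the order. For f ≠ 0 on V, f∘p does not vanish on V and so is not in Γ; if the series is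
*-potentially convergent, the positive parts of f(p(x_n)) therefore diverge, and p(x_n) → 0.

Under these conditions every point of V is a potential sum (`isPotentialSum_of_not_summable_pos`).
By Hahn–Banach, [0,1]-combinations of unused terms are dense; rounding to coefficients 0 and 1 costs
at most dim V small terms (`exists_few_fractional`); Steinitz' lemma orders each block so that
intermediate sums stay near the target. Adding the summable part gives a whole coset of Γ^⊥ inside
Σ. Conversely, a functional in Γ takes one value on Σ, so Σ lies in a single coset. -/

/-! ### Rounding coefficients in the cube -/

/-- A nontrivial direction along which a finite family of coefficients can be moved inside the cube
until one of them reaches the boundary. -/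
theorem exists_smul_direction_hits_boundary {ι : Type*} (T : Finset ι) (t g : ι → ℝ)
    (ht : ∀ i ∈ T, 0 < t i ∧ t i < 1) (hg : ∃ i ∈ T, g i ≠ 0) :
    ∃ c : ℝ, (∀ i ∈ T, 0 ≤ t i + c * g i ∧ t i + c * g i ≤ 1) ∧
      ∃ i ∈ T, t i + c * g i = 0 ∨ t i + c * g i = 1 := by
  classical
  -- The time at which coordinate `i` reaches 1 or 0; the smallest one is `c`. Indices with `g i =
  -- 0` never move and are filtered out.
  let b : ι → ℝ := fun i => if 0 < g i then (1 - t i) / g i else t i / (-g i)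
  obtain ⟨i₀, hi₀, hmin⟩ := Finset.exists_min_image (T.filter fun i => g i ≠ 0) b
    (by obtain ⟨i, hi, h⟩ := hg; exact ⟨i, by simp [hi, h]⟩)
  rw [Finset.mem_filter] at hi₀
  have hpos : ∀ i ∈ T, g i ≠ 0 → 0 < b i := by
    intro i hi h
    simp only [b]
    split_ifs with h'
    · exact div_pos (by linarith [ht i hi]) h'
    · exact div_pos (ht i hi).1 (by
        have := lt_of_le_of_ne (not_lt.1 h') h
        linarith)
  refine ⟨b i₀, fun i hi => ?_, i₀, hi₀.1, ?_⟩
  · have hb := hpos i₀ hi₀.1 hi₀.2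
    have hti := ht i hi
    rcases lt_trichotomy (g i) 0 with h | h | h
    · have hle := hmin i (by simp [hi, h.ne])
      have hbi : b i = t i / (-g i) := if_neg (not_lt.2 h.le)
      rw [hbi, le_div_iff₀ (by linarith)] at hle
      constructor
      · linarith
      · nlinarith
    · simp [h, hti.1.le, hti.2.le]
    · have hle := hmin i (by simp [hi, h.ne'])
      have hbi : b i = (1 - t i) / g i := if_pos h
      rw [hbi, le_div_iff₀ h] at hle
      constructor
      · nlinarith
      · linarith
  · rcases lt_or_gt_of_ne hi₀.2 with h | h
    · left
      have hbi : b i₀ = t i₀ / (-g i₀) := if_neg (not_lt.2 h.le)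
      rw [hbi, div_neg, neg_mul, div_mul_cancel₀ _ hi₀.2, add_neg_cancel]
    · right
      have hbi : b i₀ = (1 - t i₀) / g i₀ := if_pos h
      rw [hbi, div_mul_cancel₀ _ hi₀.2, add_sub_cancel]

/-- A combination of vectors with coefficients in `[0, 1]` can be rewritten so that the number of
coefficients different from `0` and `1` is at most the dimension of the space. -/
theorem exists_few_fractional {ι E : Type*} [AddCommGroup E] [Module ℝ E] [FiniteDimensional ℝ E]
    (s : Finset ι) (w : ι → E) (t : ι → ℝ) (ht : ∀ i ∈ s, 0 ≤ t i ∧ t i ≤ 1) :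
    ∃ t' : ι → ℝ, (∀ i ∈ s, 0 ≤ t' i ∧ t' i ≤ 1) ∧
      ∑ i ∈ s, t' i • w i = ∑ i ∈ s, t i • w i ∧
      (s.filter fun i => t' i ≠ 0 ∧ t' i ≠ 1).card ≤ Module.finrank ℝ E := by
  classical
  induction hN : (s.filter fun i => t i ≠ 0 ∧ t i ≠ 1).card using Nat.strong_induction_on
    generalizing t with
  | _ N ih =>
    subst hN
    by_cases hle : (s.filter fun i => t i ≠ 0 ∧ t i ≠ 1).card ≤ Module.finrank ℝ E
    · exact ⟨t, ht, rfl, hle⟩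
    set T := s.filter fun i => t i ≠ 0 ∧ t i ≠ 1 with hT
    have hTs : T ⊆ s := Finset.filter_subset _ _
    -- A linear relation among the fractional vectors is a direction that preserves the sum;
    -- following it to the boundary leaves fewer fractional coefficients.
    have hdep : ¬ LinearIndependent ℝ (fun i : T => w i) := fun h => by
      have := h.fintype_card_le_finrank
      rw [Fintype.card_coe] at this
      exact hle this
    obtain ⟨g₀, hg₀, i₁, hi₁⟩ := Fintype.not_linearIndependent_iff.1 hdep
    let g : ι → ℝ := fun i => if h : i ∈ T then g₀ ⟨i, h⟩ else 0
    have hgT : ∀ i : T, g i = g₀ i := fun i => by simp [g]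
    have hg_out : ∀ i, i ∉ T → g i = 0 := fun i hi => by simp [g, hi]
    have hgs : ∑ i ∈ s, g i • w i = 0 := by
      rw [← Finset.sum_subset hTs (fun i _ hi => by rw [hg_out i hi, zero_smul]),
        ← Finset.sum_coe_sort, ← hg₀]
      exact Finset.sum_congr rfl fun i _ => by rw [hgT]
    have htT : ∀ i ∈ T, 0 < t i ∧ t i < 1 := fun i hi => by
      rw [hT, Finset.mem_filter] at hi
      exact ⟨lt_of_le_of_ne (ht i hi.1).1 hi.2.1.symm, lt_of_le_of_ne (ht i hi.1).2 hi.2.2⟩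
    obtain ⟨c, hc, i₀, hi₀, hend⟩ := exists_smul_direction_hits_boundary T t g htT
      ⟨i₁, i₁.2, by rwa [hgT]⟩
    obtain ⟨t', h1, h2, h3⟩ := ih (m := (s.filter fun i =>
        t i + c * g i ≠ 0 ∧ t i + c * g i ≠ 1).card) (by
        refine Finset.card_lt_card ((Finset.ssubset_iff_of_subset ?_).2 ⟨i₀, hi₀, ?_⟩)
        · intro i hi
          by_contra hiT
          simp only [Finset.mem_filter, hg_out i hiT, mul_zero, add_zero] at hi
          exact hiT (Finset.mem_filter.2 hi)
        · simp only [Finset.mem_filter, not_and, not_not]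
          tauto) (fun i => t i + c * g i) (fun i hi => by
        by_cases hiT : i ∈ T
        · exact hc i hiT
        · simpa [hg_out i hiT] using ht i hi) rfl
    refine ⟨t', h1, h2.trans ?_, h3⟩
    simp only [add_smul, mul_smul, Finset.sum_add_distrib, ← Finset.smul_sum, hgs, smul_zero,
      add_zero]

/-! ### Steinitz' lemma -/

/-- Removal step in Steinitz' rearrangement lemma. -/
theorem exists_erase_coefficients {ι E : Type*} [DecidableEq ι] [NormedAddCommGroup E]
    [NormedSpace ℝ E] [FiniteDimensional ℝ E] (w : ι → E) (δ : ℝ) (s : Finset ι)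
    (hs : s.Nonempty) (t : ι → ℝ) (ht : ∀ i ∈ s, 0 ≤ t i ∧ t i ≤ 1)
    (hδ : ‖∑ i ∈ s, t i • w i‖ ≤ δ)
    (hsum : (s.card : ℝ) - Module.finrank ℝ E ≤ ∑ i ∈ s, t i) :
    ∃ a ∈ s, ∃ t' : ι → ℝ, (∀ i ∈ s.erase a, 0 ≤ t' i ∧ t' i ≤ 1) ∧
      ‖∑ i ∈ s.erase a, t' i • w i‖ ≤ δ ∧
      ((s.erase a).card : ℝ) - Module.finrank ℝ E ≤ ∑ i ∈ s.erase a, t' i := by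
  set d := Module.finrank ℝ E with hd
  have hδ0 : 0 ≤ δ := (norm_nonneg _).trans hδ
  rcases Nat.lt_or_ge d s.card with hlt | hle
  · have hcard : (d : ℝ) + 1 ≤ s.card := by exact_mod_cast hlt
    set S := ∑ i ∈ s, t i with hS
    have hSpos : 0 < S := by linarith
    -- Scaling by `c` makes the coefficient sum exactly what is required after one removal.
    set c : ℝ := (s.card - 1 - d) / S with hc
    have hc0 : 0 ≤ c := div_nonneg (by linarith) hSpos.le
    have hc1 : c ≤ 1 := (div_le_one hSpos).2 (by linarith)
    have hcS : c * S = s.card - 1 - d := div_mul_cancel₀ _ hSpos.ne'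
    -- The extra coordinate 1 preserves the coefficient sum, at the price of dimension `d + 1`.
    obtain ⟨t', h1, h2, h3⟩ := exists_few_fractional s (fun i => (w i, (1 : ℝ)))
      (fun i => c * t i) (fun i hi => ⟨mul_nonneg hc0 (ht i hi).1,
        mul_le_one₀ hc1 (ht i hi).1 (ht i hi).2⟩)
    have h2a : ∑ i ∈ s, t' i • w i = c • ∑ i ∈ s, t i • w i := by
      have := congrArg Prod.fst h2
      simpa [Prod.fst_sum, Finset.smul_sum, mul_smul] using this
    have h2b : ∑ i ∈ s, t' i = c * S := by
      have := congrArg Prod.snd h2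
      simpa [Prod.snd_sum, Finset.mul_sum, hS] using this
    have h3' : ((s.filter fun i => t' i ≠ 0 ∧ t' i ≠ 1).card : ℝ) ≤ d + 1 := by
      rw [Module.finrank_prod, Module.finrank_self] at h3
      exact_mod_cast h3
    -- Otherwise the deficits `1 - t' i` total `d + 1` but live on at most `d + 1` indices, each
    -- deficit being below 1.
    have hzero : ∃ a ∈ s, t' a = 0 := by
      by_contra! hne
      have hdef : ∑ i ∈ s, (1 - t' i) = d + 1 := by
        rw [Finset.sum_sub_distrib, h2b, hcS]
        simp
        ring
      have hsub : ∑ i ∈ s.filter (fun i => t' i ≠ 0 ∧ t' i ≠ 1), (1 - t' i) =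
          ∑ i ∈ s, (1 - t' i) := by
        refine Finset.sum_subset (Finset.filter_subset _ _) fun i hi hi' => ?_
        have : t' i = 1 := by
          by_contra h
          exact hi' (Finset.mem_filter.2 ⟨hi, hne i hi, h⟩)
        rw [this, sub_self]
      rw [hdef] at hsub
      rcases (s.filter fun i => t' i ≠ 0 ∧ t' i ≠ 1).eq_empty_or_nonempty with he | hne'
      · rw [he, Finset.sum_empty] at hsub
        have : (0 : ℝ) ≤ d := Nat.cast_nonneg d
        linarith
      · have hlt' := Finset.sum_lt_sum_of_nonempty hne' (f := fun i => 1 - t' i)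
          (g := fun _ => (1 : ℝ)) (fun i hi => by
            have hi := Finset.mem_filter.1 hi
            have := lt_of_le_of_ne (h1 i hi.1).1 (Ne.symm hi.2.1)
            linarith)
        rw [hsub, Finset.sum_const, nsmul_eq_mul, mul_one] at hlt'
        linarith
    obtain ⟨a, ha, hta⟩ := hzero
    refine ⟨a, ha, t', fun i hi => h1 i (Finset.mem_of_mem_erase hi), ?_, ?_⟩
    · have : ∑ i ∈ s.erase a, t' i • w i = ∑ i ∈ s, t' i • w i :=
        Finset.sum_erase s (by rw [hta, zero_smul])
      rw [this, h2a, norm_smul, Real.norm_of_nonneg hc0]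
      exact (mul_le_of_le_one_left (norm_nonneg _) hc1).trans hδ
    · rw [Finset.sum_erase s hta, h2b, hcS, Finset.card_erase_of_mem ha,
        Nat.cast_sub (Finset.card_pos.2 hs)]
      simp
  · obtain ⟨a, ha⟩ := hs
    refine ⟨a, ha, 0, fun i _ => by simp, by simpa using hδ0, ?_⟩
    have : ((s.erase a).card : ℝ) ≤ d := by
      exact_mod_cast (Finset.card_le_card (Finset.erase_subset a s)).trans hle
    simpa using this

/-- The deficits `1 - t i` total at most `d`, so raising all coefficients to 1 costs at most `d *
ε`. -/
theorem norm_sum_le_of_coefficients {ι E : Type*} [NormedAddCommGroup E]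
    [NormedSpace ℝ E] (w : ι → E) (s : Finset ι) (ε δ d : ℝ) (hw : ∀ i ∈ s, ‖w i‖ ≤ ε)
    (hε : 0 ≤ ε) (t : ι → ℝ) (ht : ∀ i ∈ s, 0 ≤ t i ∧ t i ≤ 1)
    (hδ : ‖∑ i ∈ s, t i • w i‖ ≤ δ) (hsum : (s.card : ℝ) - d ≤ ∑ i ∈ s, t i) :
    ‖∑ i ∈ s, w i‖ ≤ d * ε + δ := by
  have hsplit : ∑ i ∈ s, w i = ∑ i ∈ s, (1 - t i) • w i + ∑ i ∈ s, t i • w i := by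
    rw [← Finset.sum_add_distrib]
    exact Finset.sum_congr rfl fun i _ => by rw [← add_smul, sub_add_cancel, one_smul]
  rw [hsplit]
  refine (norm_add_le _ _).trans (add_le_add ?_ hδ)
  calc ‖∑ i ∈ s, (1 - t i) • w i‖ ≤ ∑ i ∈ s, (1 - t i) * ε := by
        refine norm_sum_le_of_le s fun i hi => ?_
        have h0 : 0 ≤ 1 - t i := by linarith [(ht i hi).2]
        rw [norm_smul, Real.norm_of_nonneg h0]
        exact mul_le_mul_of_nonneg_left (hw i hi) h0
    _ = ((s.card : ℝ) - ∑ i ∈ s, t i) * ε := by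
        rw [← Finset.sum_mul, Finset.sum_sub_distrib]
        simp
    _ ≤ d * ε := mul_le_mul_of_nonneg_right (by linarith) hε

/-- The list is built from its end: each removed element comes last, and the surviving coefficients
control the sum of the prefix before it. -/
theorem exists_list_of_coefficients {ι E : Type*} [DecidableEq ι] [NormedAddCommGroup E]
    [NormedSpace ℝ E] [FiniteDimensional ℝ E] (w : ι → E) (ε δ : ℝ) (hε : 0 ≤ ε) (s : Finset ι)
    (hw : ∀ i ∈ s, ‖w i‖ ≤ ε) (t : ι → ℝ) (ht : ∀ i ∈ s, 0 ≤ t i ∧ t i ≤ 1)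
    (hδ : ‖∑ i ∈ s, t i • w i‖ ≤ δ)
    (hsum : (s.card : ℝ) - Module.finrank ℝ E ≤ ∑ i ∈ s, t i) :
    ∃ l : List ι, l.Nodup ∧ l.toFinset = s ∧
      ∀ l', l' <+: l → ‖(l'.map w).sum‖ ≤ Module.finrank ℝ E * ε + δ := by
  induction hN : s.card generalizing s t with
  | zero =>
    rw [Finset.card_eq_zero] at hN
    subst hN
    have hδ0 : 0 ≤ δ := (norm_nonneg _).trans hδ
    refine ⟨[], by simp, by simp, fun l' hl' => ?_⟩
    rw [List.prefix_nil.1 hl']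
    simp only [List.map_nil, List.sum_nil, norm_zero]
    positivity
  | succ N ih =>
    have hs : s.Nonempty := Finset.card_pos.1 (by omega)
    obtain ⟨a, ha, t', h1, h2, h3⟩ := exists_erase_coefficients w δ s hs t ht hδ hsum
    obtain ⟨l, hnd, hl, hpre⟩ := ih (s.erase a) (fun i hi => hw i (Finset.mem_of_mem_erase hi))
      t' h1 h2 h3 (by rw [Finset.card_erase_of_mem ha, hN]; rfl)
    have hal : a ∉ l := fun h => by
      rw [← List.mem_toFinset, hl] at h
      exact Finset.notMem_erase a s h
    have hnd' : (l ++ [a]).Nodup := by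
      rw [← List.concat_eq_append, List.nodup_concat]
      exact ⟨hal, hnd⟩
    have hl' : (l ++ [a]).toFinset = s := by
      ext i
      have := Finset.ext_iff.1 hl i
      simp only [List.mem_toFinset, Finset.mem_erase] at this
      simp only [List.toFinset_append, Finset.mem_union, List.mem_toFinset, this,
        List.mem_singleton]
      by_cases hia : i = a
      · simp [hia, ha]
      · simp [hia]
    refine ⟨l ++ [a], hnd', hl', fun l' hpl => ?_⟩
    rcases List.prefix_concat_iff.1 hpl with rfl | hpl
    · rw [← List.sum_toFinset _ hnd', hl']
      exact norm_sum_le_of_coefficients w s ε δ _ hw hε t ht hδ hsum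
    · exact hpre l' hpl

/-- Steinitz' rearrangement lemma. -/
theorem exists_list_norm_prefix_sum_le {ι E : Type*} [DecidableEq ι] [NormedAddCommGroup E]
    [NormedSpace ℝ E] [FiniteDimensional ℝ E] (w : ι → E) (ε : ℝ) (hε : 0 ≤ ε) (s : Finset ι)
    (hw : ∀ i ∈ s, ‖w i‖ ≤ ε) :
    ∃ l : List ι, l.Nodup ∧ l.toFinset = s ∧
      ∀ l', l' <+: l → ‖(l'.map w).sum‖ ≤ Module.finrank ℝ E * ε + ‖∑ i ∈ s, w i‖ :=
  exists_list_of_coefficients w ε _ hε s hw (fun _ => 1) (by simp) (by simp) (by simp)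

/-! ### Approximation by finite subsums -/

/-- If the positive parts `f (y n)⁺` have infinite sum for every `f ≠ 0`, the combinations of the
`y n`, `n ∉ F`, with coefficients in `[0, 1]` are dense. -/
theorem exists_combination_near {E : Type*} [NormedAddCommGroup E] [NormedSpace ℝ E]
    (y : ℕ → E) (hy : ∀ f : E →L[ℝ] ℝ, f ≠ 0 → ¬ Summable fun n => max (f (y n)) 0)
    (F : Finset ℕ) (u : E) {ε : ℝ} (hε : 0 < ε) :
    ∃ (s : Finset ℕ) (t : ℕ → ℝ), Disjoint s F ∧ (∀ i, 0 ≤ t i ∧ t i ≤ 1) ∧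
      ‖u - ∑ i ∈ s, t i • y i‖ < ε := by
  classical
  let C : Set E := {x | ∃ (s : Finset ℕ) (t : ℕ → ℝ), Disjoint s F ∧
    (∀ i, 0 ≤ t i ∧ t i ≤ 1) ∧ (∀ i, i ∉ s → t i = 0) ∧ x = ∑ i ∈ s, t i • y i}
  have hconv : Convex ℝ C := by
    rintro _ ⟨s₁, t₁, hd₁, ht₁, ho₁, rfl⟩ _ ⟨s₂, t₂, hd₂, ht₂, ho₂, rfl⟩ a b ha hb hab
    refine ⟨s₁ ∪ s₂, fun i => a * t₁ i + b * t₂ i, Finset.disjoint_union_left.2 ⟨hd₁, hd₂⟩,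
      fun i => ⟨?_, ?_⟩, fun i hi => ?_, ?_⟩
    · have := (ht₁ i).1
      have := (ht₂ i).1
      positivity
    · nlinarith [mul_le_mul_of_nonneg_left (ht₁ i).2 ha, mul_le_mul_of_nonneg_left (ht₂ i).2 hb]
    · rw [Finset.mem_union, not_or] at hi
      simp [ho₁ i hi.1, ho₂ i hi.2]
    · rw [Finset.sum_subset (Finset.subset_union_left (s₂ := s₂))
          (fun i _ hi => by rw [ho₁ i hi, zero_smul]),
        Finset.sum_subset (Finset.subset_union_right (s₁ := s₁) (s₂ := s₂))
          (fun i _ hi => by rw [ho₂ i hi, zero_smul])]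
      simp only [add_smul, mul_smul, Finset.sum_add_distrib, ← Finset.smul_sum]
  have hmem : u ∈ closure C := by
    by_contra hu
    obtain ⟨f, c, hf, hc⟩ := geometric_hahn_banach_closed_point hconv.closure isClosed_closure hu
    have h0 : (0 : E) ∈ C := ⟨∅, 0, by simp, by simp, by simp, by simp⟩
    have hc0 : 0 < c := by simpa using hf 0 (subset_closure h0)
    have hf0 : f ≠ 0 := by
      rintro rfl
      simp only [zero_apply] at hc
      linarith
    refine hy f hf0 ?_
    have hsum : Summable fun n : {n // n ∉ F} => max (f (y n)) 0 := by
      refine summable_of_sum_le (c := c) (fun n => le_max_right _ _) fun A => ?_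
      let s : Finset ℕ := (A.map (Function.Embedding.subtype _)).filter fun n => 0 < f (y n)
      -- The indicator of the positive indices is admissible, so the separating bound `c` controls
      -- all finite sums of positive parts.
      have hC : ∑ i ∈ s, (if i ∈ s then (1 : ℝ) else 0) • y i ∈ C := by
        refine ⟨s, fun i => if i ∈ s then 1 else 0, ?_, fun i => ?_, fun i hi => if_neg hi, rfl⟩
        · refine Finset.disjoint_left.2 fun i hi => ?_
          obtain ⟨j, _, rfl⟩ := Finset.mem_map.1 (Finset.mem_filter.1 hi).1
          exact j.2
        · dsimp only
          split_ifs <;> norm_num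
      have hlt := hf _ (subset_closure hC)
      rw [map_sum] at hlt
      refine le_trans (le_of_eq ?_) hlt.le
      have : ∑ i ∈ s, f ((if i ∈ s then (1 : ℝ) else 0) • y i) = ∑ i ∈ s, max (f (y i)) 0 :=
        Finset.sum_congr rfl fun i hi => by
          rw [if_pos hi, one_smul, max_eq_left (Finset.mem_filter.1 hi).2.le]
      rw [this, Finset.sum_filter_of_ne, Finset.sum_map]
      · rfl
      · intro i _ hi
        by_contra h
        exact hi (max_eq_right (not_lt.1 h))
    have := (Finset.summable_compl_iff F (f := fun n => max (f (y n)) 0)).1 hsum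
    exact this
  obtain ⟨_, ⟨s, t, hd, ht, _, rfl⟩, hx⟩ := Metric.mem_closure_iff.1 hmem ε hε
  exact ⟨s, t, hd, ht, by rwa [← dist_eq_norm]⟩

/-- Every point is close to a finite sum of terms `y n`, `n ∉ F`, if these are small. -/
theorem exists_finset_sum_near {E : Type*} [NormedAddCommGroup E] [NormedSpace ℝ E]
    [FiniteDimensional ℝ E]
    (y : ℕ → E) (hy : ∀ f : E →L[ℝ] ℝ, f ≠ 0 → ¬ Summable fun n => max (f (y n)) 0)
    (F : Finset ℕ) (u : E) {ε : ℝ} (hε : 0 < ε) (hF : ∀ n, n ∉ F → ‖y n‖ ≤ ε) :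
    ∃ A : Finset ℕ, Disjoint A F ∧ ‖∑ i ∈ A, y i - u‖ ≤ (Module.finrank ℝ E + 1) * ε := by
  obtain ⟨s, t, hd, ht, hu⟩ := exists_combination_near y hy F u hε
  obtain ⟨t', h1, h2, h3⟩ := exists_few_fractional s y t fun i _ => ht i
  refine ⟨s.filter fun i => t' i = 1, hd.mono_left (Finset.filter_subset _ _), ?_⟩
  have hround : ∑ i ∈ s, t' i • y i - ∑ i ∈ s.filter (fun i => t' i = 1), y i =
      ∑ i ∈ s.filter (fun i => t' i ≠ 0 ∧ t' i ≠ 1), t' i • y i := by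
    rw [Finset.sum_filter, Finset.sum_filter, ← Finset.sum_sub_distrib]
    refine Finset.sum_congr rfl fun i _ => ?_
    by_cases h : t' i = 1
    · simp [h]
    · by_cases h' : t' i = 0 <;> simp [h, h']
  have hnorm : ‖∑ i ∈ s.filter (fun i => t' i ≠ 0 ∧ t' i ≠ 1), t' i • y i‖ ≤
      Module.finrank ℝ E * ε := by
    refine (norm_sum_le_of_le _ (f := fun i => t' i • y i) (n := fun _ => ε)
      fun i hi => ?_).trans ?_
    · have hi := (Finset.mem_filter.1 hi).1
      rw [norm_smul, Real.norm_of_nonneg (h1 i hi).1]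
      exact (mul_le_of_le_one_left (norm_nonneg _) (h1 i hi).2).trans
        (hF i (Finset.disjoint_left.1 hd hi))
    · rw [Finset.sum_const, nsmul_eq_mul]
      exact mul_le_mul_of_nonneg_right (by exact_mod_cast h3) hε.le
  have hsplit : ∑ i ∈ s.filter (fun i => t' i = 1), y i - u =
      -(∑ i ∈ s.filter (fun i => t' i ≠ 0 ∧ t' i ≠ 1), t' i • y i) -
        (u - ∑ i ∈ s, t i • y i) := by
    rw [← hround, h2]
    abel
  rw [hsplit]
  refine (norm_sub_le _ _).trans ?_
  rw [norm_neg]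
  linarith

/-! ### Building the permutation block by block -/

/-- An increasing chain of lists without repetitions that exhausts `ℕ` defines a permutation. -/
theorem exists_perm_of_list_chain (L : ℕ → List ℕ) (hnd : ∀ k, (L k).Nodup)
    (hpre : ∀ k, L k <+: L (k + 1)) (hmem : ∀ k, k ∈ L (k + 1)) :
    ∃ σ : Equiv.Perm ℕ, ∀ k m, m ≤ (L k).length → (List.range m).map σ = (L k).take m := by
  have hmono : ∀ j k, j ≤ k → L j <+: L k := fun j k h => by
    induction h with
    | refl => exact List.prefix_rfl
    | step _ ih => exact ih.trans (hpre _)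
  have hlen : ∀ k, k ≤ (L k).length := fun k => by
    have hsub : Finset.range k ⊆ (L k).toFinset := fun j hj => by
      rw [Finset.mem_range] at hj
      exact List.mem_toFinset.2 ((hmono (j + 1) k hj).subset (hmem j))
    have := Finset.card_le_card hsub
    rw [Finset.card_range] at this
    exact this.trans (List.toFinset_card_le _)
  let e : ℕ → ℕ := fun n => (L (n + 1))[n]'(hlen (n + 1))
  have he : ∀ k n (h : n < (L k).length), e n = (L k)[n] := fun k n h => by
    rcases le_total k (n + 1) with hk | hk
    · exact ((hmono _ _ hk).getElem h).symm
    · exact (hmono _ _ hk).getElem (hlen (n + 1))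
  have hbij : Function.Bijective e := by
    constructor
    · intro a b hab
      have ha : a < (L (a + b + 1)).length := lt_of_lt_of_le (by omega) (hlen _)
      have hb : b < (L (a + b + 1)).length := lt_of_lt_of_le (by omega) (hlen _)
      rw [he _ a ha, he _ b hb] at hab
      exact (hnd _).getElem_inj_iff.1 hab
    · intro n
      obtain ⟨i, hi, hin⟩ := List.getElem_of_mem (hmem n)
      exact ⟨i, (he _ i hi).trans hin⟩
  refine ⟨Equiv.ofBijective e hbij, fun k m hm => ?_⟩
  refine List.ext_getElem (by simp [hm]) fun i h1 h2 => ?_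
  simp only [List.getElem_map, List.getElem_range, List.getElem_take, Equiv.ofBijective_apply]
  exact he k i _

/-- One step of the construction of a rearrangement with sum `v`. -/
theorem exists_list_extension {E : Type*} [NormedAddCommGroup E] [NormedSpace ℝ E]
    [FiniteDimensional ℝ E] (y : ℕ → E)
    (hy : ∀ f : E →L[ℝ] ℝ, f ≠ 0 → ¬ Summable fun n => max (f (y n)) 0)
    (hlim : Filter.Tendsto y Filter.atTop (nhds 0)) (v : E) (k : ℕ) (l : List ℕ) (hl : l.Nodup)
    {ε ε' : ℝ} (hε : 0 ≤ ε) (hε' : 0 < ε') (hsmall : ∀ n, n ∉ l → ‖y n‖ ≤ ε) :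
    ∃ M : List ℕ, (l ++ M).Nodup ∧ k ∈ l ++ M ∧ ‖((l ++ M).map y).sum - v‖ ≤ ε' ∧
      (∀ n, n ∉ l ++ M → ‖y n‖ ≤ ε') ∧
      ∀ M', M' <+: M → ‖((l ++ M').map y).sum - v‖ ≤
        Module.finrank ℝ E * ε + (2 * ‖(l.map y).sum - v‖ + ε') := by
  set d := Module.finrank ℝ E with hd
  -- Chosen to absorb the factor `d + 1` in `exists_finset_sum_near`.
  set η : ℝ := ε' / (d + 1) with hη
  have hd1 : (0 : ℝ) < d + 1 := by positivity
  have hη0 : 0 < η := div_pos hε' hd1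
  have hηε : η ≤ ε' := div_le_self hε'.le (by linarith [(Nat.cast_nonneg d : (0 : ℝ) ≤ d)])
  obtain ⟨N, hN⟩ := Metric.tendsto_atTop.1 hlim η hη0
  simp only [dist_zero_right] at hN
  -- Used indices, the index `k` (for surjectivity), and an initial segment beyond which terms are
  -- small.
  let F : Finset ℕ := l.toFinset ∪ insert k (Finset.range N)
  have hF : ∀ n, n ∉ F → ‖y n‖ ≤ η := fun n hn => by
    refine (hN n ?_).le
    by_contra h
    exact hn (Finset.mem_union_right _ (Finset.mem_insert_of_mem (Finset.mem_range.2 (by omega))))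
  obtain ⟨A, hA, hAv⟩ := exists_finset_sum_near y hy F (v - ∑ i ∈ F, y i) hη0 hF
  rw [show ((Module.finrank ℝ E : ℝ) + 1) * η = ε' from mul_div_cancel₀ _ hd1.ne'] at hAv
  have hlF : l.toFinset ⊆ F ∪ A := Finset.subset_union_left.trans Finset.subset_union_left
  obtain ⟨M, hM, hMs, hMpre⟩ := exists_list_norm_prefix_sum_le y ε hε ((F ∪ A) \ l.toFinset)
    (fun i hi => hsmall i fun h => (Finset.mem_sdiff.1 hi).2 (List.mem_toFinset.2 h))
  have hMmem : ∀ n, n ∈ M ↔ n ∈ F ∪ A ∧ n ∉ l := fun n => by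
    rw [← List.mem_toFinset, hMs, Finset.mem_sdiff, List.mem_toFinset]
  have hmem : ∀ n, n ∈ l ++ M ↔ n ∈ F ∪ A := fun n => by
    rw [List.mem_append, hMmem]
    by_cases hn : n ∈ l
    · simp only [hn, true_or, true_iff]
      exact hlF (List.mem_toFinset.2 hn)
    · simp [hn]
  have hnd : (l ++ M).Nodup := List.nodup_append'.2 ⟨hl, hM, fun n h1 h2 => ((hMmem n).1 h2).2 h1⟩
  have hfin : (l ++ M).toFinset = F ∪ A := by
    ext n
    rw [List.mem_toFinset, hmem]
  have hsumv : ‖((l ++ M).map y).sum - v‖ ≤ ε' := by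
    rw [← List.sum_toFinset _ hnd, hfin, Finset.sum_union hA.symm]
    convert hAv using 2
    abel
  refine ⟨M, hnd, ?_, hsumv, fun n hn => ?_, fun M' hM' => ?_⟩
  · rw [hmem]
    simp [F]
  · rw [hmem] at hn
    exact (hF n fun h => hn (Finset.mem_union_left _ h)).trans hηε
  · have h1 := hMpre M' hM'
    rw [← hMs, List.sum_toFinset _ hM] at h1
    have h2 : ‖(M.map y).sum‖ ≤ ‖(l.map y).sum - v‖ + ε' := by
      have : (M.map y).sum = (((l ++ M).map y).sum - v) - ((l.map y).sum - v) := by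
        rw [List.map_append, List.sum_append]
        abel
      rw [this]
      linarith [norm_sub_le (((l ++ M).map y).sum - v) ((l.map y).sum - v)]
    have h3 : ((l ++ M').map y).sum - v = (M'.map y).sum + ((l.map y).sum - v) := by
      rw [List.map_append, List.sum_append]
      abel
    rw [h3]
    linarith [norm_add_le (M'.map y).sum ((l.map y).sum - v)]

/-- If `y n → 0` and the positive parts of `f (y n)` have infinite sum for every `f ≠ 0`, then
every point is a potential sum. -/
theorem isPotentialSum_of_not_summable_pos {E : Type*} [NormedAddCommGroup E] [NormedSpace ℝ E]
    [FiniteDimensional ℝ E] (y : ℕ → E)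
    (hy : ∀ f : E →L[ℝ] ℝ, f ≠ 0 → ¬ Summable fun n => max (f (y n)) 0)
    (hlim : Filter.Tendsto y Filter.atTop (nhds 0)) (v : E) : IsPotentialSum y v := by
  set d := Module.finrank ℝ E with hd
  let ε : ℕ → ℝ := fun k => 1 / ((k : ℝ) + 1)
  have hεpos : ∀ k, 0 < ε k := fun k => Nat.one_div_pos_of_nat
  have hεanti : ∀ j k, j ≤ k → ε k ≤ ε j := fun j k h => Nat.one_div_le_one_div h
  let P : ℕ → List ℕ → Prop := fun k l =>
    l.Nodup ∧ ‖(l.map y).sum - v‖ ≤ ε k ∧ ∀ n, n ∉ l → ‖y n‖ ≤ ε k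
  have hP0 : ∃ l, P 0 l := by
    obtain ⟨B, hB⟩ := hlim.norm.bddAbove_range
    have hB' : ∀ n, ‖y n‖ ≤ B := fun n => hB ⟨n, rfl⟩
    obtain ⟨M, h1, _, h2, h3, _⟩ := exists_list_extension y hy hlim v 0 [] List.nodup_nil
      ((norm_nonneg _).trans (hB' 0)) (hεpos 0) fun n _ => hB' n
    exact ⟨[] ++ M, h1, h2, h3⟩
  have hstep : ∀ k (l : {l // P k l}), ∃ M, P (k + 1) (l.1 ++ M) ∧ k ∈ l.1 ++ M ∧
      ∀ M', M' <+: M → ‖((l.1 ++ M').map y).sum - v‖ ≤ (d + 3) * ε k := by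
    rintro k ⟨l, hl1, hl2, hl3⟩
    obtain ⟨M, h1, h2, h3, h4, h5⟩ := exists_list_extension y hy hlim v k l hl1 (hεpos k).le
      (hεpos (k + 1)) hl3
    -- The factor `d + 3` collects `d * ε k` from Steinitz, `2 * ε k` from the previous error and `ε
    -- (k + 1) ≤ ε k`.
    refine ⟨M, ⟨h1, h3, h4⟩, h2, fun M' hM' => (h5 M' hM').trans ?_⟩
    have := hεanti k (k + 1) (Nat.le_succ k)
    linarith
  choose M hM1 hM2 hM3 using hstep
  obtain ⟨l₀, hl₀⟩ := hP0
  let S : ∀ k, {l // P k l} := fun k =>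
    Nat.rec ⟨l₀, hl₀⟩ (fun k l => ⟨l.1 ++ M k l, hM1 k l⟩) k
  have hS : ∀ k, (S (k + 1)).1 = (S k).1 ++ M k (S k) := fun k => rfl
  obtain ⟨σ, hσ⟩ := exists_perm_of_list_chain (fun k => (S k).1) (fun k => (S k).2.1)
    (fun k => ⟨M k (S k), rfl⟩) (fun k => hM2 k (S k))
  have hlen : ∀ k, k ≤ (S k).1.length := fun k => by
    have hsub : ∀ j k, j ≤ k → (S j).1 ⊆ (S k).1 := fun j k h => by
      induction h with
      | refl => exact List.Subset.refl _
      | step _ ih => exact List.Subset.trans ih (List.subset_append_left _ _)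
    have hr : Finset.range k ⊆ (S k).1.toFinset := fun j hj => by
      rw [Finset.mem_range] at hj
      exact List.mem_toFinset.2 (hsub (j + 1) k hj (hM2 j (S j)))
    have := Finset.card_le_card hr
    rw [Finset.card_range] at this
    exact this.trans (List.toFinset_card_le _)
  refine ⟨σ, Metric.tendsto_atTop.2 fun r hr => ?_⟩
  have hlim' : Filter.Tendsto (fun k => ((d : ℝ) + 3) * ε k) Filter.atTop (nhds 0) := by
    simpa [ε] using (tendsto_one_div_add_atTop_nhds_zero_nat (𝕜 := ℝ)).const_mul ((d : ℝ) + 3)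
  obtain ⟨K, hK⟩ := (hlim'.eventually (gt_mem_nhds hr)).exists
  refine ⟨(S K).1.length, fun m hm => ?_⟩
  have hex : ∃ j, m < (S j).1.length := ⟨m + 1, hlen (m + 1)⟩
  classical
  -- The block `k` in which the partial sum of length `m` ends.
  obtain ⟨k, hKk, hk1, hk2⟩ : ∃ k, K ≤ k ∧ (S k).1.length ≤ m ∧ m ≤ (S (k + 1)).1.length := by
    have hmono : Monotone fun k => (S k).1.length := monotone_nat_of_le_succ fun k => by
      rw [hS, List.length_append]
      exact Nat.le_add_right _ _
    have hfind := Nat.find_spec hex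
    have hKf : K < Nat.find hex := by
      by_contra h
      exact absurd (hmono (not_lt.1 h)) (by simpa using lt_of_le_of_lt hm hfind)
    obtain ⟨k, hk⟩ := Nat.exists_eq_succ_of_ne_zero (Nat.ne_of_gt (Nat.zero_lt_of_lt hKf))
    refine ⟨k, by omega, ?_, ?_⟩
    · exact not_lt.1 (Nat.find_min hex (by omega))
    · rw [hk] at hfind
      exact hfind.le
  have hsum : ∑ n ∈ Finset.range m, y (σ n) =
      (((S k).1 ++ (M k (S k)).take (m - (S k).1.length)).map y).sum := by
    have h1 := hσ (k + 1) m hk2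
    rw [hS, List.take_append, List.take_of_length_le hk1] at h1
    rw [← h1, List.map_map, ← List.sum_toFinset _ List.nodup_range, List.toFinset_range]
    rfl
  rw [dist_eq_norm, hsum]
  refine (hM3 k (S k) _ (List.take_prefix _ _)).trans_lt (lt_of_le_of_lt ?_ hK)
  exact mul_le_mul_of_nonneg_left (hεanti K k hKk) (by positivity)

/-! ### Duality and behaviour of potential sums -/

/-- The functionals that make the series absolutely convergent form a subspace. -/
def absSummableSubmodule {X : Type*} [AddCommGroup X] [Module ℝ X] (x : ℕ → X) :
    Submodule ℝ (Module.Dual ℝ X) where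
  carrier := {f | Summable fun n => |f (x n)|}
  zero_mem' := by simp
  add_mem' := fun {f g} hf hg => Summable.of_nonneg_of_le (fun _ => abs_nonneg _)
    (fun n => abs_add_le (f (x n)) (g (x n))) (Summable.add hf hg)
  smul_mem' := fun c f hf => by
    simpa [abs_mul] using Summable.mul_left |c| hf

/-- All functionals are continuous in finite dimension, so Γ may be treated as a subspace of the
algebraic dual, where biduality applies. -/
theorem mem_annihilator_iff {X : Type*} [NormedAddCommGroup X] [NormedSpace ℝ X]
    [FiniteDimensional ℝ X] (x : ℕ → X) (v : X) :
    v ∈ annihilator (absSummableFunctionals x) ↔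
      v ∈ (absSummableSubmodule x).dualCoannihilator := by
  simp only [annihilator, absSummableFunctionals, Set.mem_iInter, Set.mem_ofPred_eq,
    Set.mem_preimage, Set.mem_singleton_iff, Submodule.mem_dualCoannihilator]
  constructor
  · intro h f hf
    exact h (LinearMap.toContinuousLinearMap f) hf
  · intro h f hf
    exact h (f : X →ₗ[ℝ] ℝ) hf

/-- A functional vanishing on the annihilator of `Γ` belongs to `Γ`. -/
theorem summable_abs_of_vanish_annihilator {X : Type*} [NormedAddCommGroup X] [NormedSpace ℝ X]
    [FiniteDimensional ℝ X] (x : ℕ → X) (f : Module.Dual ℝ X)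
    (hf : ∀ v ∈ (absSummableSubmodule x).dualCoannihilator, f v = 0) :
    Summable fun n => |f (x n)| := by
  have h : f ∈ (absSummableSubmodule x).dualCoannihilator.dualAnnihilator :=
    (Submodule.mem_dualAnnihilator f).2 hf
  rw [Subspace.dualCoannihilator_dualAnnihilator_eq] at h
  exact h

theorem summable_of_forall_dual {X : Type*} [NormedAddCommGroup X] [NormedSpace ℝ X]
    [FiniteDimensional ℝ X] (z : ℕ → X) (hz : ∀ f : Module.Dual ℝ X, Summable fun n => f (z n)) :
    Summable z := by
  have h : z = fun n => ∑ i, (Module.finBasis ℝ X).coord i (z n) • Module.finBasis ℝ X i :=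
    funext fun n => ((Module.finBasis ℝ X).sum_repr (z n)).symm
  rw [h]
  exact summable_sum fun i _ => (hz _).smul_const _

theorem tendsto_zero_of_forall_dual {X : Type*} [NormedAddCommGroup X] [NormedSpace ℝ X]
    [FiniteDimensional ℝ X] (z : ℕ → X)
    (hz : ∀ f : Module.Dual ℝ X, Filter.Tendsto (fun n => f (z n)) Filter.atTop (nhds 0)) :
    Filter.Tendsto z Filter.atTop (nhds 0) := by
  have h : z = fun n => ∑ i, (Module.finBasis ℝ X).coord i (z n) • Module.finBasis ℝ X i :=
    funext fun n => ((Module.finBasis ℝ X).sum_repr (z n)).symm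
  rw [h]
  simpa using tendsto_finsetSum (Finset.univ : Finset (Fin (Module.finrank ℝ X)))
    fun i _ => (hz ((Module.finBasis ℝ X).coord i)).smul_const (Module.finBasis ℝ X i)

theorem IsPotentialSum.tendsto_zero {X : Type*} [NormedAddCommGroup X] {x : ℕ → X} {s : X}
    (h : IsPotentialSum x s) : Filter.Tendsto x Filter.atTop (nhds 0) := by
  obtain ⟨σ, hσ⟩ := h
  have h1 : Filter.Tendsto (fun m => x (σ m)) Filter.atTop (nhds 0) := by
    simpa [Finset.sum_range_succ] using (hσ.comp (Filter.tendsto_add_atTop_nat 1)).sub hσ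
  have h2 : Filter.Tendsto σ.symm Filter.atTop Filter.atTop := by
    rw [← Nat.cofinite_eq_atTop]
    exact σ.symm.injective.tendsto_cofinite
  simpa [Function.comp_def] using h1.comp h2

theorem IsPotentialSum.map {X Y : Type*} [NormedAddCommGroup X] [NormedSpace ℝ X]
    [NormedAddCommGroup Y] [NormedSpace ℝ Y] {x : ℕ → X} {s : X}
    (h : IsPotentialSum x s) (f : X →L[ℝ] Y) : IsPotentialSum (fun n => f (x n)) (f s) := by
  obtain ⟨σ, hσ⟩ := h
  refine ⟨σ, ?_⟩
  simpa [Function.comp_def] using (f.continuous.tendsto s).comp hσ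

/-- A summable series can be rearranged arbitrarily. -/
theorem IsPotentialSum.add_hasSum {X : Type*} [NormedAddCommGroup X] {y z : ℕ → X} {s t : X}
    (hy : IsPotentialSum y s) (hz : HasSum z t) : IsPotentialSum (fun n => y n + z n) (s + t) := by
  obtain ⟨σ, hσ⟩ := hy
  refine ⟨σ, ?_⟩
  simp only [Finset.sum_add_distrib]
  exact hσ.add ((σ.hasSum_iff (f := z)).2 hz).tendsto_sum_nat

theorem IsPotentialSum.eq_of_hasSum {X : Type*} [NormedAddCommGroup X] {z : ℕ → X} {s t : X}
    (hs : IsPotentialSum z s) (hz : HasSum z t) : s = t := by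
  obtain ⟨σ, hσ⟩ := hs
  exact tendsto_nhds_unique hσ ((σ.hasSum_iff (f := z)).2 hz).tendsto_sum_nat

/-- A potentially convergent real series with summable positive part converges absolutely. -/
theorem IsPotentialSum.summable_abs {a : ℕ → ℝ} {r : ℝ} (h : IsPotentialSum a r)
    (hpos : Summable fun n => max (a n) 0) : Summable fun n => |a n| := by
  obtain ⟨σ, hσ⟩ := h
  have hpos' : Summable fun n => max (a (σ n)) 0 :=
    (σ.summable_iff (f := fun n => max (a n) 0)).2 hpos
  have hneg : Filter.Tendsto (fun m => ∑ n ∈ Finset.range m, (max (a (σ n)) 0 - a (σ n)))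
      Filter.atTop (nhds (∑' n, max (a (σ n)) 0 - r)) := by
    simp only [Finset.sum_sub_distrib]
    exact hpos'.hasSum.tendsto_sum_nat.sub hσ
  -- Negative parts are nonnegative with convergent partial sums, hence summable in any order.
  have hneg' : Summable fun n => max (a (σ n)) 0 - a (σ n) :=
    ((hasSum_iff_tendsto_nat_of_nonneg (fun n => sub_nonneg.2 (le_max_left _ _)) _).2 hneg).summable
  have ha : Summable fun n => a (σ n) := by simpa using hpos'.sub hneg'
  exact ((σ.summable_iff (f := a)).1 ha).abs

/-! ### Σ as a coset of the annihilator -/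

/-- For a *-potentially convergent series some translate of the annihilator of `Γ` consists of
potential sums. -/
theorem exists_forall_isPotentialSum_add {X : Type*} [NormedAddCommGroup X] [NormedSpace ℝ X]
    [FiniteDimensional ℝ X] (x : ℕ → X) (hx : StarPotentiallyConvergent x) :
    ∃ s : X, ∀ v ∈ annihilator (absSummableFunctionals x), IsPotentialSum x (s + v) := by
  set V : Submodule ℝ X := (absSummableSubmodule x).dualCoannihilator with hV
  obtain ⟨p, hp⟩ := LinearMap.exists_leftInverse_of_injective V.subtype V.ker_subtype
  have hpV : ∀ v : V, p (v : X) = v := fun v => LinearMap.congr_fun hp v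
  have hlim : Filter.Tendsto (fun n => p (x n)) Filter.atTop (nhds 0) := by
    refine tendsto_zero_of_forall_dual _ fun f => ?_
    obtain ⟨r, hr⟩ := hx (LinearMap.toContinuousLinearMap (f ∘ₗ p))
    exact hr.tendsto_zero
  have hdiv : ∀ f : V →L[ℝ] ℝ, f ≠ 0 → ¬ Summable fun n => max (f (p (x n))) 0 := by
    intro f hf hsum
    obtain ⟨r, hr⟩ := hx (LinearMap.toContinuousLinearMap ((f : V →ₗ[ℝ] ℝ) ∘ₗ p))
    have habs := hr.summable_abs hsum
    refine hf (ContinuousLinearMap.ext fun v => ?_)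
    -- `f ∘ p` would lie in Γ and vanish on `V`, where it equals `f`.
    have := (Submodule.mem_dualCoannihilator _).1 v.2 ((f : V →ₗ[ℝ] ℝ) ∘ₗ p) habs
    simpa [hpV] using this
  have hz : Summable fun n => x n - (p (x n) : X) := by
    refine summable_of_forall_dual _ fun f => ?_
    have := summable_abs_of_vanish_annihilator x (f - f ∘ₗ V.subtype ∘ₗ p) fun v hv => by
      simp [hpV ⟨v, hv⟩]
    refine this.of_abs.congr fun n => ?_
    simp
  refine ⟨∑' n, (x n - (p (x n) : X)), fun v hv => ?_⟩
  have hvV : v ∈ V := (mem_annihilator_iff x v).1 hv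
  have hy := (isPotentialSum_of_not_summable_pos _ hdiv hlim ⟨v, hvV⟩).map V.subtypeL
  simpa [add_comm] using hy.add_hasSum hz.hasSum

theorem sub_mem_annihilator_of_isPotentialSum {X : Type*} [NormedAddCommGroup X]
    [NormedSpace ℝ X] {x : ℕ → X} {s t : X} (hs : IsPotentialSum x s) (ht : IsPotentialSum x t) :
    t - s ∈ annihilator (absSummableFunctionals x) := by
  simp only [annihilator, absSummableFunctionals, Set.mem_iInter, Set.mem_ofPred_eq,
    Set.mem_preimage, Set.mem_singleton_iff]
  intro f hf
  rw [map_sub, (hs.map f).eq_of_hasSum hf.of_abs.hasSum, (ht.map f).eq_of_hasSum hf.of_abs.hasSum,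
    sub_self]

theorem starPotentiallyConvergent_of_isPotentialSum {X : Type*} [NormedAddCommGroup X]
    [NormedSpace ℝ X] {x : ℕ → X} {s : X} (hs : IsPotentialSum x s) :
    StarPotentiallyConvergent x :=
  fun f => ⟨f s, hs.map f⟩

/-- The potential sums form a coset of the annihilator of `Γ`. -/
theorem isPotentialSum_iff_sub_mem {X : Type*} [NormedAddCommGroup X] [NormedSpace ℝ X]
    [FiniteDimensional ℝ X] {x : ℕ → X} {s : X} (hs : IsPotentialSum x s) (t : X) :
    IsPotentialSum x t ↔ t - s ∈ (absSummableSubmodule x).dualCoannihilator := by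
  rw [← mem_annihilator_iff]
  refine ⟨sub_mem_annihilator_of_isPotentialSum hs, fun h => ?_⟩
  obtain ⟨s₀, hs₀⟩ := exists_forall_isPotentialSum_add x
    (starPotentiallyConvergent_of_isPotentialSum hs)
  have h0 : IsPotentialSum x s₀ := by
    simpa using hs₀ 0 ((mem_annihilator_iff x 0).2 (Submodule.zero_mem _))
  have h1 := sub_mem_annihilator_of_isPotentialSum h0 hs
  rw [mem_annihilator_iff] at h h1
  -- Uses `t - s₀ = (t - s) + (s - s₀)`.
  have h2 := hs₀ _ ((mem_annihilator_iff x _).2 (Submodule.add_mem _ h h1))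
  convert h2 using 1
  abel

theorem mainTheorem1 {X : Type*} [NormedAddCommGroup X] [NormedSpace ℝ X]
    [FiniteDimensional ℝ X] (x : ℕ → X) :
    (∃ A : AffineSubspace ℝ X, (A : Set X) = potentialSums x) ∧
    potentialSums x = potentialSums x + annihilator (absSummableFunctionals x) ∧
    ((potentialSums x).Nonempty ↔ StarPotentiallyConvergent x) := by
  refine ⟨?_, ?_, ?_, ?_⟩
  · rcases (potentialSums x).eq_empty_or_nonempty with h | ⟨s, hs⟩
    · exact ⟨⊥, by simp [h]⟩
    · refine ⟨AffineSubspace.mk' s (absSummableSubmodule x).dualCoannihilator, ?_⟩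
      ext t
      exact (isPotentialSum_iff_sub_mem hs t).symm
  · ext t
    constructor
    · intro ht
      exact ⟨t, ht, 0, (mem_annihilator_iff x 0).2 (Submodule.zero_mem _), add_zero t⟩
    · rintro ⟨s, hs, v, hv, rfl⟩
      refine (isPotentialSum_iff_sub_mem hs _).2 ?_
      rw [← mem_annihilator_iff]
      simpa using hv
  · rintro ⟨s, hs⟩
    exact starPotentiallyConvergent_of_isPotentialSum hs
  · intro h
    obtain ⟨s, hs⟩ := exists_forall_isPotentialSum_add x h
    exact ⟨s + 0, hs 0 ((mem_annihilator_iff x 0).2 (Submodule.zero_mem _))⟩
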